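/- **Upward Löwenheim–Skolem theorem for $QLET_F$.** *Syntax.* A signature is a pair $\mathcal S=\langle\mathcal C,\mathcal P\rangle$ of an infinite set $\mathcal C$ of individual constants and a set $\mathcal P$ of predicate letters of finite arities, which contains the binary identity symbol $=$; its cardinality is $|\mathcal C\cup\mathcal P|$. Formulas are built from variables $v_0,v_1,\dots$, constants and predicate letters with $\neg,\circ,\bullet,\wedge,\vee,\forall,\exists$, void quantifiers being excluded ($\forall xA$ and $\exists xA$ are formulas only if $x$ is free in $A$); sentences are formulas without free variables. $A(t/x)$ is the result of replacing every free occurrence of $x$ in $A$ by $t$. Alphabetic variants are formulas that differ only in (some of) their bound variables. *Structures.* An $\mathcal S$-structure $\mathfrak A$ consists of a non-empty domain $D$, an element $c^{\mathfrak A}\in D$ for every $c\in\mathcal C$, and, for every $n$-ary $P\in\mathcal P$, an extension $P_+^{\mathfrak A}\subseteq D^n$ and an anti-extension $P_-^{\mathfrak A}\subseteq D^n$ (not required to be disjoint or exhaustive), where $=_+^{\mathfrak A}$ is $\{\langle a,a\rangle: a\in D\}$. The diagram signature $\mathcal S_{\mathfrak A}$ adds to $\mathcal S$ a new constant $\bar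 a$, denoting $a$, for every $a\in D$; write $c^{\widehat{\mathfrak A}}$ for the denotation of a constant $c$ of $\mathcal S_{\mathfrak A}$. *Valuations.* An $\mathfrak A$-valuation is a map $v$ from the sentences of $\mathcal S_{\mathfrak A}$ to $\{0,1\}$ such that: 1. $v(P(c_1,\dots,c_n))=1$ iff $\langle c_1^{\widehat{\mathfrak A}},\dots,c_n^{\widehat{\mathfrak A}}\rangle\in P_+^{\mathfrak A}$; 2. $v(\neg P(c_1,\dots,c_n))=1$ iff $\langle c_1^{\widehat{\mathfrak A}},\dots,c_n^{\widehat{\mathfrak A}}\rangle\in P_-^{\mathfrak A}$; 3. $v(A\wedge B)=1$ iff $v(A)=1$ and $v(B)=1$; 4. $v(A\vee B)=1$ iff $v(A)=1$ or $v(B)=1$; 5. $v(\neg(A\wedge B))=1$ iff $v(\neg A)=1$ or $v(\neg B)=1$; 6. $v(\neg(A\vee B))=1$ iff $v(\neg A)=1$ and $v(\neg B)=1$; 7. $v(\neg\neg A)=1$ iff $v(A)=1$; 8. if $v(\circ A)=1$, then $v(A)=1$ iff $v(\neg A)=0$; 9. $v(\circ A)=1$ iff $v(\bullet A)=0$; 10.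 $v(\forall xA)=1$ iff $v(A(\bar a/x))=1$ for every $a\in D$; 11. $v(\exists xA)=1$ iff $v(A(\bar a/x))=1$ for some $a\in D$; 12. $v(\neg\forall xA)=1$ iff $v(\neg A(\bar a/x))=1$ for some $a\in D$; 13. $v(\neg\exists xA)=1$ iff $v(\neg A(\bar a/x))=1$ for every $a\in D$; 14. $v(A')=v(A)$ whenever $A'$ is an alphabetic variant of $A$; 15. if no variable other than $x$ is free in the formula $A$, $c_1^{\widehat{\mathfrak A}}=c_2^{\widehat{\mathfrak A}}$ and $v(A(c_1/x))=v(A(c_2/x))$, then $v(\#A(c_1/x))=v(\#A(c_2/x))$ for each $\#\in\{\neg,\circ,\bullet\}$. An $\mathcal S$-interpretation is a pair $\langle\mathfrak A,v\rangle$ of an $\mathcal S$-structure and an $\mathfrak A$-valuation; its cardinality is $|D|$. It is a model of a set $\Gamma$ of sentences of $\mathcal S$ if $v(A)=1$ for every $A\in\Gamma$, and $\Gamma\vDash A$ means that $v(A)=1$ for every model $\langle\mathfrak A,v\rangle$ of $\Gamma$. *Theorem.* Let $\mathcal S$ be a signature of cardinality $\lambda$ and let $\Gamma$ be a set of sentences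 of $\mathcal S$ such that $\Gamma\vDash\forall x\forall y\,\circ(x=y)$, where $x$ and $y$ are distinct variables. If $\Gamma$ has an infinite model, then for every cardinal $\kappa\ge\lambda$, $\Gamma$ has a model of cardinality $\kappa$. -/

import Mathlib

universe u

namespace QLETF

/-- A first-order signature: an infinite set of individual constants and, for every `n`, a set of
`n`-ary predicate letters, with a distinguished binary predicate letter, the identity symbol. -/
structure Signature : Type (u + 1) where
  Const : Type u
  infinite_const : Infinite Const
  Pred : ℕ → Type u
  eq : Pred 2

/-- The cardinality of a signature: the number of its constants and predicate letters (the identity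
symbol included). -/
def Signature.card (S : Signature.{u}) : Cardinal.{u} :=
  Cardinal.mk (S.Const ⊕ (Σ n, S.Pred n))

/-- Terms: the individual variables `v₀, v₁, …` and the individual constants. -/
inductive Term (S : Signature.{u}) : Type u
  | var (i : ℕ) : Term S
  | const (c : S.Const) : Term S

/-- Formulas, with void quantifiers still allowed (they are excluded by `PreFormula.IsFormula`). -/
inductive PreFormula (S : Signature.{u}) : Type u
  | rel {n : ℕ} (P : S.Pred n) (ts : Fin n → Term S) : PreFormula S
  | neg (A : PreFormula S) : PreFormula S
  | circ (A : PreFormula S) : PreFormula S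
  | bullet (A : PreFormula S) : PreFormula S
  | and (A B : PreFormula S) : PreFormula S
  | or (A B : PreFormula S) : PreFormula S
  | all (x : ℕ) (A : PreFormula S) : PreFormula S
  | ex (x : ℕ) (A : PreFormula S) : PreFormula S

/-- `t(s/x)`: the term `t` with the variable `x` replaced by the term `s`. -/
def Term.subst {S : Signature.{u}} (x : ℕ) (s : Term S) : Term S → Term S
  | .var i => if i = x then s else .var i
  | .const c => .const c

/-- Replace every constant by its image under a map of constants. -/
def Term.mapConst {S T : Signature.{u}} (f : S.Const → T.Const) : Term S → Term T
  | .var i => .var i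
  | .const c => .const (f c)

namespace PreFormula

variable {S T : Signature.{u}}

/-- The atomic formula `s = t`. -/
def eq (s t : Term S) : PreFormula S := .rel S.eq ![s, t]

/-- The variable `x` has a free occurrence in the formula. -/
def FreeIn (x : ℕ) : PreFormula S → Prop
  | rel _ ts => ∃ i, ts i = .var x
  | neg A => FreeIn x A
  | circ A => FreeIn x A
  | bullet A => FreeIn x A
  | and A B => FreeIn x A ∨ FreeIn x B
  | or A B => FreeIn x A ∨ FreeIn x B
  | all y A => x ≠ y ∧ FreeIn x A
  | ex y A => x ≠ y ∧ FreeIn x A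

/-- The variable `x` occurs in the formula: free, bound, or next to a quantifier. -/
def Occurs (x : ℕ) : PreFormula S → Prop
  | rel _ ts => ∃ i, ts i = .var x
  | neg A => Occurs x A
  | circ A => Occurs x A
  | bullet A => Occurs x A
  | and A B => Occurs x A ∨ Occurs x B
  | or A B => Occurs x A ∨ Occurs x B
  | all y A => x = y ∨ Occurs x A
  | ex y A => x = y ∨ Occurs x A

/-- No quantifier is void: every quantified variable is free in the scope of its quantifier. -/
def IsFormula : PreFormula S → Prop
  | rel _ _ => True
  | neg A => IsFormula A
  | circ A => IsFormula A
  | bullet A => IsFormula A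
  | and A B => IsFormula A ∧ IsFormula B
  | or A B => IsFormula A ∧ IsFormula B
  | all x A => FreeIn x A ∧ IsFormula A
  | ex x A => FreeIn x A ∧ IsFormula A

/-- `A(t/x)`: the result of replacing every free occurrence of `x` in `A` by `t`. -/
def subst (x : ℕ) (t : Term S) : PreFormula S → PreFormula S
  | rel P ts => rel P fun i => Term.subst x t (ts i)
  | neg A => neg (subst x t A)
  | circ A => circ (subst x t A)
  | bullet A => bullet (subst x t A)
  | and A B => and (subst x t A) (subst x t B)
  | or A B => or (subst x t A) (subst x t B)
  | all y A => if y = x then all y A else all y (subst x t A)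
  | ex y A => if y = x then ex y A else ex y (subst x t A)

/-- Alphabetic variants: the formulas differ only in (some of) their bound variables. This is the
least congruence that relates `∀xA` to `∀yA(y/x)`, and `∃xA` to `∃yA(y/x)`, whenever `y` does not
occur in `A`. -/
inductive AlphVar : PreFormula S → PreFormula S → Prop
  | refl (A : PreFormula S) : AlphVar A A
  | symm {A B : PreFormula S} : AlphVar A B → AlphVar B A
  | trans {A B C : PreFormula S} : AlphVar A B → AlphVar B C → AlphVar A C
  | neg {A A' : PreFormula S} : AlphVar A A' → AlphVar (neg A) (neg A')
  | circ {A A' : PreFormula S} : AlphVar A A' → AlphVar (circ A) (circ A')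
  | bullet {A A' : PreFormula S} : AlphVar A A' → AlphVar (bullet A) (bullet A')
  | and {A A' B B' : PreFormula S} :
      AlphVar A A' → AlphVar B B' → AlphVar (and A B) (and A' B')
  | or {A A' B B' : PreFormula S} :
      AlphVar A A' → AlphVar B B' → AlphVar (or A B) (or A' B')
  | all (x : ℕ) {A A' : PreFormula S} : AlphVar A A' → AlphVar (all x A) (all x A')
  | ex (x : ℕ) {A A' : PreFormula S} : AlphVar A A' → AlphVar (ex x A) (ex x A')
  | all_rename (x y : ℕ) (A : PreFormula S) (hy : ¬ Occurs y A) :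
      AlphVar (all x A) (all y (subst x (.var y) A))
  | ex_rename (x y : ℕ) (A : PreFormula S) (hy : ¬ Occurs y A) :
      AlphVar (ex x A) (ex y (subst x (.var y) A))

end PreFormula

/-- A translation between signatures: a map of constants and an arity-preserving map of predicate
letters that respects the identity symbol. -/
structure Signature.Hom (S T : Signature.{u}) : Type u where
  onConst : S.Const → T.Const
  onPred : ∀ {n : ℕ}, S.Pred n → T.Pred n
  map_eq : onPred S.eq = T.eq

namespace PreFormula

variable {S T : Signature.{u}}

/-- Translate a formula along a translation of signatures. -/
def map (f : Signature.Hom S T) : PreFormula S → PreFormula T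
  | rel P ts => rel (f.onPred P) fun i => (ts i).mapConst f.onConst
  | neg A => neg (map f A)
  | circ A => circ (map f A)
  | bullet A => bullet (map f A)
  | and A B => and (map f A) (map f B)
  | or A B => or (map f A) (map f B)
  | all x A => all x (map f A)
  | ex x A => ex x (map f A)

theorem freeIn_subst_const (x y : ℕ) (c : S.Const) (A : PreFormula S) :
    FreeIn y (subst x (.const c) A) ↔ y ≠ x ∧ FreeIn y A := by
  induction A with
  | rel P ts =>
    simp only [subst, FreeIn]
    have key : ∀ t : Term S, Term.subst x (.const c) t = .var y ↔ y ≠ x ∧ t = .var y := by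
      intro t
      cases t with
      | var i =>
        by_cases h : i = x
        · simp only [Term.subst, h, if_true, Term.var.injEq]
          constructor
          · intro h'; cases h'
          · rintro ⟨h1, h2⟩; exact absurd h2.symm h1
        · simp only [Term.subst, h, if_false, Term.var.injEq]
          constructor
          · rintro rfl; exact ⟨h, rfl⟩
          · exact fun h' => h'.2
      | const d => simp [Term.subst]
    simp [key]
  | neg A ih => exact ih
  | circ A ih => exact ih
  | bullet A ih => exact ih
  | and A B ihA ihB => simp only [subst, FreeIn, ihA, ihB]; tauto
  | or A B ihA ihB => simp only [subst, FreeIn, ihA, ihB]; tauto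
  | all z A ih =>
    by_cases h : z = x
    · subst h; simp [subst, FreeIn]
    · simp only [subst, h, if_false, FreeIn, ih]; tauto
  | ex z A ih =>
    by_cases h : z = x
    · subst h; simp [subst, FreeIn]
    · simp only [subst, h, if_false, FreeIn, ih]; tauto

theorem IsFormula.subst_const {A : PreFormula S} (h : A.IsFormula) (x : ℕ) (c : S.Const) :
    (A.subst x (.const c)).IsFormula := by
  induction A with
  | rel P ts => trivial
  | neg A ih => exact ih h
  | circ A ih => exact ih h
  | bullet A ih => exact ih h
  | and A B ihA ihB => exact ⟨ihA h.1, ihB h.2⟩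
  | or A B ihA ihB => exact ⟨ihA h.1, ihB h.2⟩
  | all z A ih =>
    by_cases hz : z = x
    · simpa only [PreFormula.subst, hz, if_true] using h
    · simp only [PreFormula.subst, hz, if_false]
      exact ⟨(freeIn_subst_const x z c A).2 ⟨hz, h.1⟩, ih h.2⟩
  | ex z A ih =>
    by_cases hz : z = x
    · simpa only [PreFormula.subst, hz, if_true] using h
    · simp only [PreFormula.subst, hz, if_false]
      exact ⟨(freeIn_subst_const x z c A).2 ⟨hz, h.1⟩, ih h.2⟩

theorem freeIn_map (f : Signature.Hom S T) (y : ℕ) (A : PreFormula S) :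
    FreeIn y (map f A) ↔ FreeIn y A := by
  induction A with
  | rel P ts =>
    have key : ∀ t : Term S, t.mapConst f.onConst = .var y ↔ t = .var y := by
      intro t
      cases t <;> simp [Term.mapConst]
    simp only [map, FreeIn, key]
  | neg A ih => exact ih
  | circ A ih => exact ih
  | bullet A ih => exact ih
  | and A B ihA ihB => exact or_congr ihA ihB
  | or A B ihA ihB => exact or_congr ihA ihB
  | all z A ih => exact and_congr_right fun _ => ih
  | ex z A ih => exact and_congr_right fun _ => ih

theorem isFormula_map (f : Signature.Hom S T) (A : PreFormula S) :
    IsFormula (map f A) ↔ IsFormula A := by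
  induction A with
  | rel P ts => exact Iff.rfl
  | neg A ih => exact ih
  | circ A ih => exact ih
  | bullet A ih => exact ih
  | and A B ihA ihB => exact and_congr ihA ihB
  | or A B ihA ihB => exact and_congr ihA ihB
  | all z A ih => exact and_congr (freeIn_map f z A) ih
  | ex z A ih => exact and_congr (freeIn_map f z A) ih

end PreFormula

/-- Formulas in which no variable other than `x` is free. -/
def UnaryFormula (S : Signature.{u}) (x : ℕ) : Type u :=
  {A : PreFormula S // A.IsFormula ∧ ∀ y, A.FreeIn y → y = x}

/-- Sentences: formulas without free variables. -/
def Sentence (S : Signature.{u}) : Type u :=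
  {A : PreFormula S // A.IsFormula ∧ ∀ y, ¬ A.FreeIn y}

/-- `A(c/x)`, for a constant `c` and a formula `A` with no free variable other than `x`. -/
def UnaryFormula.inst {S : Signature.{u}} {x : ℕ} (A : UnaryFormula S x) (c : S.Const) :
    Sentence S :=
  ⟨A.1.subst x (.const c), A.2.1.subst_const x c, fun y hy =>
    let h := (PreFormula.freeIn_subst_const x y c A.1).1 hy
    h.1 (A.2.2 y h.2)⟩

namespace Sentence

variable {S T : Signature.{u}}

/-- The atomic sentence `P(c₁, …, cₙ)`. -/
def rel {n : ℕ} (P : S.Pred n) (c : Fin n → S.Const) : Sentence S :=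
  ⟨.rel P fun i => .const (c i), trivial, fun _ hy => hy.elim fun _ hi => nomatch hi⟩

def neg (A : Sentence S) : Sentence S := ⟨.neg A.1, A.2⟩

def circ (A : Sentence S) : Sentence S := ⟨.circ A.1, A.2⟩

def bullet (A : Sentence S) : Sentence S := ⟨.bullet A.1, A.2⟩

def and (A B : Sentence S) : Sentence S :=
  ⟨.and A.1 B.1, ⟨A.2.1, B.2.1⟩, fun y hy => hy.elim (A.2.2 y) (B.2.2 y)⟩

def or (A B : Sentence S) : Sentence S :=
  ⟨.or A.1 B.1, ⟨A.2.1, B.2.1⟩, fun y hy => hy.elim (A.2.2 y) (B.2.2 y)⟩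

/-- `∀xA`, where `x` is the one and only variable that is free in `A`. -/
def all {x : ℕ} (A : UnaryFormula S x) (hx : A.1.FreeIn x) : Sentence S :=
  ⟨.all x A.1, ⟨hx, A.2.1⟩, fun y hy => hy.1 (A.2.2 y hy.2)⟩

/-- `∃xA`, where `x` is the one and only variable that is free in `A`. -/
def ex {x : ℕ} (A : UnaryFormula S x) (hx : A.1.FreeIn x) : Sentence S :=
  ⟨.ex x A.1, ⟨hx, A.2.1⟩, fun y hy => hy.1 (A.2.2 y hy.2)⟩

/-- Translate a sentence along a translation of signatures. -/
def map (f : Signature.Hom S T) (A : Sentence S) : Sentence T :=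
  ⟨A.1.map f, (PreFormula.isFormula_map f A.1).2 A.2.1, fun y hy =>
    A.2.2 y ((PreFormula.freeIn_map f y A.1).1 hy)⟩

/-- The sentence `∀x∀y∘(x = y)`, for distinct variables `x` and `y`. -/
def allCircEq (S : Signature.{u}) (x y : ℕ) (hxy : x ≠ y) : Sentence S :=
  ⟨.all x (.all y (.circ (.eq (.var x) (.var y)))),
    ⟨⟨hxy, 0, rfl⟩, ⟨1, rfl⟩, trivial⟩, by
      rintro z ⟨hzx, hzy, i, hi⟩
      fin_cases i
      · exact hzx (Term.var.inj hi).symm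
      · exact hzy (Term.var.inj hi).symm⟩

end Sentence

/-- An `S`-structure: a non-empty domain, an element of it for every constant, and an extension
`pos P` and an anti-extension `neg P` for every predicate letter `P`; the extension of the identity
symbol is the identity relation, its anti-extension is arbitrary. -/
structure Structure (S : Signature.{u}) : Type (u + 1) where
  Domain : Type u
  nonempty_domain : Nonempty Domain
  const : S.Const → Domain
  pos : ∀ {n : ℕ}, S.Pred n → Set (Fin n → Domain)
  neg : ∀ {n : ℕ}, S.Pred n → Set (Fin n → Domain)
  pos_eq : pos S.eq = {t | t 0 = t 1}

/-- The diagram signature of a structure: a new constant `Sum.inr a` is added for every element `a`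
of the domain. -/
def Structure.diagram {S : Signature.{u}} (𝔄 : Structure S) : Signature.{u} where
  Const := S.Const ⊕ 𝔄.Domain
  infinite_const := have := S.infinite_const; inferInstance
  Pred := S.Pred
  eq := S.eq

/-- The constant `ā` of the diagram signature that names the element `a` of the domain. -/
def Structure.name {S : Signature.{u}} (𝔄 : Structure S) (a : 𝔄.Domain) : 𝔄.diagram.Const :=
  Sum.inr a

/-- The inclusion of a signature in a diagram signature. -/
def Structure.toDiagram {S : Signature.{u}} (𝔄 : Structure S) : Signature.Hom S 𝔄.diagram where
  onConst := Sum.inl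
  onPred := fun P => P
  map_eq := rfl

/-- The expansion of `𝔄` to the diagram signature, in which `ā` denotes `a`. -/
def Structure.hat {S : Signature.{u}} (𝔄 : Structure S) : Structure 𝔄.diagram where
  Domain := 𝔄.Domain
  nonempty_domain := 𝔄.nonempty_domain
  const := Sum.elim 𝔄.const id
  pos := fun {n} (P : S.Pred n) => 𝔄.pos P
  neg := fun {n} (P : S.Pred n) => 𝔄.neg P
  pos_eq := 𝔄.pos_eq

/-- The `𝔄`-valuations: non-deterministic two-valued valuations of the sentences of the diagram
language of `𝔄`. -/
structure IsValuation {S : Signature.{u}} (𝔄 : Structure S) (v : Sentence 𝔄.diagram → Bool) :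
    Prop where
  rel : ∀ {n : ℕ} (P : 𝔄.diagram.Pred n) (c : Fin n → 𝔄.diagram.Const),
    v (.rel P c) = true ↔ (fun i => 𝔄.hat.const (c i)) ∈ 𝔄.hat.pos P
  neg_rel : ∀ {n : ℕ} (P : 𝔄.diagram.Pred n) (c : Fin n → 𝔄.diagram.Const),
    v (.neg (.rel P c)) = true ↔ (fun i => 𝔄.hat.const (c i)) ∈ 𝔄.hat.neg P
  and : ∀ A B, v (.and A B) = true ↔ v A = true ∧ v B = true
  or : ∀ A B, v (.or A B) = true ↔ v A = true ∨ v B = true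
  neg_and : ∀ A B, v (.neg (.and A B)) = true ↔ v (.neg A) = true ∨ v (.neg B) = true
  neg_or : ∀ A B, v (.neg (.or A B)) = true ↔ v (.neg A) = true ∧ v (.neg B) = true
  neg_neg : ∀ A, v (.neg (.neg A)) = true ↔ v A = true
  of_circ : ∀ A, v (.circ A) = true → (v A = true ↔ v (.neg A) = false)
  circ : ∀ A, v (.circ A) = true ↔ v (.bullet A) = false
  all : ∀ {x : ℕ} (A : UnaryFormula 𝔄.diagram x) (hx : A.1.FreeIn x),
    v (.all A hx) = true ↔ ∀ a : 𝔄.Domain, v (A.inst (𝔄.name a)) = true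
  ex : ∀ {x : ℕ} (A : UnaryFormula 𝔄.diagram x) (hx : A.1.FreeIn x),
    v (.ex A hx) = true ↔ ∃ a : 𝔄.Domain, v (A.inst (𝔄.name a)) = true
  neg_all : ∀ {x : ℕ} (A : UnaryFormula 𝔄.diagram x) (hx : A.1.FreeIn x),
    v (.neg (.all A hx)) = true ↔ ∃ a : 𝔄.Domain, v (.neg (A.inst (𝔄.name a))) = true
  neg_ex : ∀ {x : ℕ} (A : UnaryFormula 𝔄.diagram x) (hx : A.1.FreeIn x),
    v (.neg (.ex A hx)) = true ↔ ∀ a : 𝔄.Domain, v (.neg (A.inst (𝔄.name a))) = true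
  alphVar : ∀ A A' : Sentence 𝔄.diagram, PreFormula.AlphVar A.1 A'.1 → v A' = v A
  subst : ∀ {x : ℕ} (A : UnaryFormula 𝔄.diagram x) (c₁ c₂ : 𝔄.diagram.Const),
    𝔄.hat.const c₁ = 𝔄.hat.const c₂ → v (A.inst c₁) = v (A.inst c₂) →
      v (.neg (A.inst c₁)) = v (.neg (A.inst c₂)) ∧
      v (.circ (A.inst c₁)) = v (.circ (A.inst c₂)) ∧
      v (.bullet (A.inst c₁)) = v (.bullet (A.inst c₂))

/-- An `S`-interpretation: an `S`-structure `𝔄` together with an `𝔄`-valuation. -/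
structure Interpretation (S : Signature.{u}) : Type (u + 1) where
  str : Structure S
  val : Sentence str.diagram → Bool
  isValuation : IsValuation str val

namespace Interpretation

variable {S : Signature.{u}}

/-- The cardinality of an interpretation: that of its domain. -/
def card (M : Interpretation S) : Cardinal.{u} := Cardinal.mk M.str.Domain

/-- The sentence `A` holds in the interpretation. -/
def Holds (M : Interpretation S) (A : Sentence S) : Prop :=
  M.val (A.map M.str.toDiagram) = true

/-- The interpretation is a model of `Γ`: every element of `Γ` holds in it. -/
def IsModel (M : Interpretation S) (Γ : Set (Sentence S)) : Prop := ∀ A ∈ Γ, M.Holds A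

end Interpretation

/-- Semantic consequence: `A` holds in every model of `Γ`. -/
def Entails {S : Signature.{u}} (Γ : Set (Sentence S)) (A : Sentence S) : Prop :=
  ∀ M : Interpretation S, M.IsModel Γ → M.Holds A

end QLETF

namespace QLETF

variable {S T U : Signature.{u}}

/-! A valuation is not determined by its structure, so truth cannot be defined by recursion and the
classical theorem does not apply to the structure alone. The remedy is to make truth itself
primitive. Let the slots be extra constants serving as placeholders. In the language `classical S`,
every sentence with `n` slots is an `n`-ary relation symbol, and `Sat A a` reads "`A` is true when
its slots are filled by `a`". An interpretation is then an ordinary first-order structure on the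
same domain.

Each valuation clause, for fixed sentences, is the universal closure of one first-order formula,
because a quantifier clause only asks about the value of one further slot. These conditions form
`Coherent`. They hold in the structure of an interpretation (`Interpretation.coherent`) and pass to
elementarily equivalent structures (`Coherent.of_equiv`). Conversely, a coherent structure yields an
interpretation (`Coherent.toInterpretation`): every diagram sentence is a filled slot sentence, and
its truth does not depend on how it is so written (`Coherent.sat_congr`).

The language `classical S` is no larger than `S` (`card_classical_le`), so the classical
Löwenheim–Skolem theorem provides an elementarily equivalent structure of cardinality `κ`, which is
decoded into the required model. -/

/-- Composition of translations. -/
def Signature.Hom.comp (g : Signature.Hom T U) (f : Signature.Hom S T) : Signature.Hom S U where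
  onConst := g.onConst ∘ f.onConst
  onPred := fun P => g.onPred (f.onPred P)
  map_eq := by rw [f.map_eq, g.map_eq]

/-! ### Constants in formulas and translations between signatures -/

namespace PreFormula

/-- The constants that occur in a formula. -/
def consts : PreFormula S → Set S.Const
  | rel _ ts => {c | ∃ i, ts i = .const c}
  | neg A => consts A
  | circ A => consts A
  | bullet A => consts A
  | and A B => consts A ∪ consts B
  | or A B => consts A ∪ consts B
  | all _ A => consts A
  | ex _ A => consts A

/-- Finiteness is what lets a diagram sentence be rewritten with finitely many slots. -/
theorem finite_consts (A : PreFormula S) : A.consts.Finite := by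
  induction A with
  | rel P ts =>
    refine ((Set.finite_range ts).preimage (f := Term.const) ?_).subset ?_
    · intro a _ b _ h
      exact Term.const.inj h
    · rintro c ⟨i, hi⟩
      exact ⟨i, hi⟩
  | neg A ih => exact ih
  | circ A ih => exact ih
  | bullet A ih => exact ih
  | and A B ihA ihB => exact ihA.union ihB
  | or A B ihA ihB => exact ihA.union ihB
  | all x A ih => exact ih
  | ex x A ih => exact ih

theorem map_comp (g : Signature.Hom T U) (f : Signature.Hom S T) (A : PreFormula S) :
    map (g.comp f) A = map g (map f A) := by
  induction A with
  | rel P ts =>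
    simp only [map]
    congr 1
    funext i
    cases ts i <;> rfl
  | _ => simp_all [map]

theorem map_eq_self {f : Signature.Hom S S} (hP : ∀ {n} (P : S.Pred n), f.onPred P = P)
    {A : PreFormula S} (h : ∀ c ∈ A.consts, f.onConst c = c) : map f A = A := by
  induction A with
  | rel P ts =>
    simp only [map, hP]
    congr 1
    funext i
    cases hi : ts i with
    | var j => rfl
    | const c => simp only [Term.mapConst, h c ⟨i, hi⟩]
  | neg A ih => simp only [map, ih h]
  | circ A ih => simp only [map, ih h]
  | bullet A ih => simp only [map, ih h]
  | and A B ihA ihB =>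
    simp only [map, ihA fun c hc => h c (.inl hc), ihB fun c hc => h c (.inr hc)]
  | or A B ihA ihB =>
    simp only [map, ihA fun c hc => h c (.inl hc), ihB fun c hc => h c (.inr hc)]
  | all x A ih => simp only [map, ih h]
  | ex x A ih => simp only [map, ih h]

theorem map_subst (f : Signature.Hom S T) (x : ℕ) (t : Term S) (A : PreFormula S) :
    map f (subst x t A) = subst x (t.mapConst f.onConst) (map f A) := by
  induction A with
  | rel P ts =>
    simp only [map, subst]
    congr 1
    funext i
    cases ts i with
    | var j => by_cases h : j = x <;> simp [Term.subst, Term.mapConst, h]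
    | const c => rfl
  | all y A ih => by_cases h : y = x <;> simp [map, subst, h, ih]
  | ex y A ih => by_cases h : y = x <;> simp [map, subst, h, ih]
  | _ => simp_all [map, subst]

theorem occurs_map (f : Signature.Hom S T) (y : ℕ) (A : PreFormula S) :
    Occurs y (map f A) ↔ Occurs y A := by
  induction A with
  | rel P ts =>
    have key : ∀ t : Term S, t.mapConst f.onConst = .var y ↔ t = .var y := by
      intro t
      cases t <;> simp [Term.mapConst]
    simp only [map, Occurs, key]
  | _ => simp_all [map, Occurs]

/-- Translations act on constants and predicate letters only, so the freshness condition on the new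
bound variable survives and substitution commutes with them. -/
theorem AlphVar.map (f : Signature.Hom S T) {A B : PreFormula S} (h : AlphVar A B) :
    AlphVar (A.map f) (B.map f) := by
  induction h with
  | refl A => exact .refl _
  | symm _ ih => exact .symm ih
  | trans _ _ ih₁ ih₂ => exact .trans ih₁ ih₂
  | neg _ ih => exact .neg ih
  | circ _ ih => exact .circ ih
  | bullet _ ih => exact .bullet ih
  | and _ _ ih₁ ih₂ => exact .and ih₁ ih₂
  | or _ _ ih₁ ih₂ => exact .or ih₁ ih₂
  | all x _ ih => exact .all x ih
  | ex x _ ih => exact .ex x ih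
  | all_rename x y A hy =>
    have := AlphVar.all_rename x y (A.map f) (mt (occurs_map f y A).1 hy)
    simpa only [PreFormula.map, map_subst, Term.mapConst] using this
  | ex_rename x y A hy =>
    have := AlphVar.ex_rename x y (A.map f) (mt (occurs_map f y A).1 hy)
    simpa only [PreFormula.map, map_subst, Term.mapConst] using this

/-! ### The number of formulas -/

/-- The root of a formula, seen as a tree whose leaves are the atomic formulas. -/
inductive Root (S : Signature.{u}) : Type u
  | rel (P : Σ n, S.Pred n) (ts : Fin P.1 → Term S)
  | neg
  | circ
  | bullet
  | and
  | or
  | all (x : ℕ)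
  | ex (x : ℕ)

/-- The number of immediate subformulas of a formula with a given root. -/
def Root.arity : Root S → ℕ
  | rel _ _ => 0
  | neg => 1
  | circ => 1
  | bullet => 1
  | and => 2
  | or => 2
  | all _ => 1
  | ex _ => 1

/-- The tree of a formula. -/
def toTree : PreFormula S → WType fun r : Root S => Fin r.arity
  | rel P ts => ⟨.rel ⟨_, P⟩ ts, Fin.elim0⟩
  | neg A => ⟨.neg, fun _ => toTree A⟩
  | circ A => ⟨.circ, fun _ => toTree A⟩
  | bullet A => ⟨.bullet, fun _ => toTree A⟩
  | and A B => ⟨.and, Fin.cases (toTree A) fun _ => toTree B⟩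
  | or A B => ⟨.or, Fin.cases (toTree A) fun _ => toTree B⟩
  | all x A => ⟨.all x, fun _ => toTree A⟩
  | ex x A => ⟨.ex x, fun _ => toTree A⟩

/-- Formulas thereby embed in a finitely branching W-type, whose cardinality is at most that of its
set of roots or `ℵ₀`. -/
theorem toTree_injective : Function.Injective (toTree (S := S)) := by
  intro A
  induction A with
  | rel P ts =>
    intro B h
    cases B <;> obtain ⟨h₁, -⟩ := WType.mk.inj h <;> cases h₁
    rfl
  | and A₁ A₂ ih₁ ih₂ | or A₁ A₂ ih₁ ih₂ =>
    intro B h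
    cases B <;> obtain ⟨h₁, h₂⟩ := WType.mk.inj h <;> cases h₁
    have h' := eq_of_heq h₂
    rw [ih₁ (congrFun h' (0 : Fin 2)), ih₂ (congrFun h' (1 : Fin 2))]
  | neg A ih | circ A ih | bullet A ih | all x A ih | ex x A ih =>
    intro B h
    cases B <;> obtain ⟨h₁, h₂⟩ := WType.mk.inj h <;> cases h₁
    have h' := eq_of_heq h₂
    rw [ih (congrFun h' (0 : Fin 1))]

end PreFormula

section Cardinality

open Cardinal

theorem Signature.aleph0_le_card (S : Signature.{u}) : ℵ₀ ≤ S.card := by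
  have := S.infinite_const
  exact (aleph0_le_mk _).trans (mk_le_of_injective (Sum.inl_injective (β := Σ n, S.Pred n)))

theorem Term.mk_le (S : Signature.{u}) : #(Term S) ≤ S.card := by
  have h : #(Term S) ≤ #(ULift.{u} ℕ ⊕ S.Const) := by
    refine mk_le_of_injective (f := fun t => match t with
      | .var i => Sum.inl ⟨i⟩
      | .const c => Sum.inr c) ?_
    intro s t h
    cases s <;> cases t <;> simp_all
  refine h.trans ?_
  rw [mk_sum, lift_id, lift_id]
  exact add_le_of_le S.aleph0_le_card (by simpa using S.aleph0_le_card)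
    (mk_le_of_injective (Sum.inl_injective (β := Σ n, S.Pred n)))

theorem PreFormula.Root.mk_le (S : Signature.{u}) : #(Root S) ≤ S.card := by
  have hω := S.aleph0_le_card
  -- The argument tuple of an atom becomes a list; the seven other kinds of root get a tag and a
  -- variable index, with `0` as a dummy when there is no variable.
  have h : #(Root S) ≤ #(((Σ n, S.Pred n) × List (Term S)) ⊕ ULift.{u} (Fin 7 × ℕ)) := by
    refine mk_le_of_injective (f := fun t => match t with
      | .rel P ts => Sum.inl (P, List.ofFn ts)
      | .neg => Sum.inr ⟨0, 0⟩
      | .circ => Sum.inr ⟨1, 0⟩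
      | .bullet => Sum.inr ⟨2, 0⟩
      | .and => Sum.inr ⟨3, 0⟩
      | .or => Sum.inr ⟨4, 0⟩
      | .all x => Sum.inr ⟨5, x⟩
      | .ex x => Sum.inr ⟨6, x⟩) ?_
    intro s t h
    cases s <;> cases t <;> simp_all
    obtain ⟨rfl, h⟩ := h
    simpa using h
  refine h.trans ?_
  rw [mk_sum, lift_id, lift_id, mk_prod, lift_id, lift_id]
  refine add_le_of_le hω (mul_le_of_le hω ?_ ?_) ?_
  · exact mk_le_of_injective (Sum.inr_injective (α := S.Const))
  · exact (mk_list_le_max _).trans (max_le hω (Term.mk_le S))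
  · exact (mk_le_aleph0 (α := ULift.{u} (Fin 7 × ℕ))).trans hω

theorem PreFormula.mk_le (S : Signature.{u}) : #(PreFormula S) ≤ S.card := by
  refine (mk_le_of_injective toTree_injective).trans ?_
  refine (WType.cardinalMk_le_max_aleph0_of_finite' (β := fun r : Root S => Fin r.arity)).trans ?_
  rw [lift_uzero]
  exact max_le (Root.mk_le S) S.aleph0_le_card

theorem Sentence.mk_le (S : Signature.{u}) : #(Sentence S) ≤ S.card :=
  (mk_subtype_le _).trans (PreFormula.mk_le S)

end Cardinality

/-! ### Translations of sentences and of formulas with one free variable -/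

namespace Sentence

theorem map_comp (g : Signature.Hom T U) (f : Signature.Hom S T) (A : Sentence S) :
    A.map (g.comp f) = (A.map f).map g :=
  Subtype.ext (PreFormula.map_comp g f A.1)

theorem map_eq_self {f : Signature.Hom S S} (hP : ∀ {n} (P : S.Pred n), f.onPred P = P)
    {A : Sentence S} (h : ∀ c ∈ A.1.consts, f.onConst c = c) : A.map f = A :=
  Subtype.ext (PreFormula.map_eq_self hP h)

end Sentence

namespace UnaryFormula

variable {x : ℕ}

/-- Translate a formula with at most one free variable along a translation of signatures. -/
def map (f : Signature.Hom S T) (A : UnaryFormula S x) : UnaryFormula T x :=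
  ⟨A.1.map f, (PreFormula.isFormula_map f A.1).2 A.2.1, fun y hy =>
    A.2.2 y ((PreFormula.freeIn_map f y A.1).1 hy)⟩

theorem map_comp (g : Signature.Hom T U) (f : Signature.Hom S T) (A : UnaryFormula S x) :
    A.map (g.comp f) = (A.map f).map g :=
  Subtype.ext (PreFormula.map_comp g f A.1)

theorem map_eq_self {f : Signature.Hom S S} (hP : ∀ {n} (P : S.Pred n), f.onPred P = P)
    {A : UnaryFormula S x} (h : ∀ c ∈ A.1.consts, f.onConst c = c) : A.map f = A :=
  Subtype.ext (PreFormula.map_eq_self hP h)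

theorem map_inst (f : Signature.Hom S T) (A : UnaryFormula S x) (c : S.Const) :
    (A.inst c).map f = (A.map f).inst (f.onConst c) :=
  Subtype.ext (PreFormula.map_subst f x (.const c) A.1)

end UnaryFormula

/-! ### Slots as placeholders for names of elements -/

/-- The signature `S` with `n` additional constants, the slots. -/
def Signature.slots (S : Signature.{u}) (n : ℕ) : Signature.{u} where
  Const := S.Const ⊕ ULift.{u} (Fin n)
  infinite_const := have := S.infinite_const; inferInstance
  Pred := S.Pred
  eq := S.eq

/-- The `i`-th slot. -/
def Signature.slot (S : Signature.{u}) {n : ℕ} (i : Fin n) : (S.slots n).Const := Sum.inr ⟨i⟩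

/-- The inclusion of a signature in its extension by slots. -/
def Signature.toSlots (S : Signature.{u}) (n : ℕ) : Signature.Hom S (S.slots n) where
  onConst := Sum.inl
  onPred := fun P => P
  map_eq := rfl

/-- The renaming of slots along a map. -/
def Signature.renameSlots (S : Signature.{u}) {m n : ℕ} (f : Fin m → Fin n) :
    Signature.Hom (S.slots m) (S.slots n) where
  onConst := Sum.map id fun i => ⟨f i.down⟩
  onPred := fun P => P
  map_eq := rfl

namespace Structure

/-- The translation that fills the slots with names of elements of a structure. -/
def fill (𝔄 : Structure S) {n : ℕ} (a : Fin n → 𝔄.Domain) :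
    Signature.Hom (S.slots n) 𝔄.diagram where
  onConst := Sum.map id fun i => a i.down
  onPred := fun P => P
  map_eq := rfl

/-- The translation that replaces the names of the elements of a structure by slots. -/
def unfill (𝔄 : Structure S) {n : ℕ} (j : 𝔄.Domain → Fin n) :
    Signature.Hom 𝔄.diagram (S.slots n) where
  onConst := Sum.map id fun a => ⟨j a⟩
  onPred := fun P => P
  map_eq := rfl

variable (𝔄 : Structure S)

theorem fill_comp_renameSlots {m n : ℕ} (f : Fin m → Fin n) (a : Fin n → 𝔄.Domain) :
    (𝔄.fill a).comp (S.renameSlots f) = 𝔄.fill (a ∘ f) := by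
  have : (𝔄.fill a).onConst ∘ (S.renameSlots f).onConst = (𝔄.fill (a ∘ f)).onConst := by
    funext c
    cases c <;> rfl
  simp only [Signature.Hom.comp, this]
  rfl

theorem unfill_comp_fill {m n : ℕ} (j : 𝔄.Domain → Fin n) (a : Fin m → 𝔄.Domain) :
    (𝔄.unfill j).comp (𝔄.fill a) = S.renameSlots (j ∘ a) := by
  have : (𝔄.unfill j).onConst ∘ (𝔄.fill a).onConst = (S.renameSlots (j ∘ a)).onConst := by
    funext c
    cases c <;> rfl
  simp only [Signature.Hom.comp, this]
  rfl

/-- Finitely many constants of the diagram signature can be replaced by slots, reversibly. -/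
theorem exists_unfill {F : Set 𝔄.diagram.Const} (hF : F.Finite) :
    ∃ (n : ℕ) (a : Fin n → 𝔄.Domain) (j : 𝔄.Domain → Fin n),
      ∀ c ∈ F, (𝔄.fill a).onConst ((𝔄.unfill j).onConst c) = c := by
  classical
  obtain ⟨a₀⟩ := 𝔄.nonempty_domain
  -- The extra element `a₀` guarantees at least one slot, to which all elements not named in `F` are
  -- sent.
  let G : Set 𝔄.Domain := insert a₀ {a | 𝔄.name a ∈ F}
  have hG : G.Finite :=
    (hF.preimage (f := 𝔄.name) fun _ _ _ _ h => Sum.inr_injective h).insert a₀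
  have : Finite G := hG
  obtain ⟨n, ⟨e⟩⟩ := Finite.exists_equiv_fin G
  refine ⟨n, fun i => (e.symm i).1,
    fun a => if h : a ∈ G then e ⟨a, h⟩ else e ⟨a₀, Set.mem_insert _ _⟩, ?_⟩
  rintro (c | a) hc
  · rfl
  · have ha : a ∈ G := Set.mem_insert_of_mem _ hc
    simp [fill, unfill, ha]
    rfl

theorem map_unfill_fill {n : ℕ} {a : Fin n → 𝔄.Domain} {j : 𝔄.Domain → Fin n}
    {A : Sentence 𝔄.diagram}
    (h : ∀ c ∈ A.1.consts, (𝔄.fill a).onConst ((𝔄.unfill j).onConst c) = c) :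
    (A.map (𝔄.unfill j)).map (𝔄.fill a) = A := by
  rw [← Sentence.map_comp]
  exact Sentence.map_eq_self (fun _ => rfl) h

theorem map_unfill_fill_unary {n x : ℕ} {a : Fin n → 𝔄.Domain} {j : 𝔄.Domain → Fin n}
    {A : UnaryFormula 𝔄.diagram x}
    (h : ∀ c ∈ A.1.consts, (𝔄.fill a).onConst ((𝔄.unfill j).onConst c) = c) :
    (A.map (𝔄.unfill j)).map (𝔄.fill a) = A := by
  rw [← UnaryFormula.map_comp]
  exact UnaryFormula.map_eq_self (fun _ => rfl) h

end Structure

/-- `A(c/x)` for a fresh slot `c`. -/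
def UnaryFormula.instLast {n x : ℕ} (A : UnaryFormula (S.slots n) x) : Sentence (S.slots (n + 1)) :=
  (A.map (S.renameSlots Fin.castSucc)).inst (S.slot (Fin.last n))

/-- This turns instantiation by names into variation of the last argument of a relation symbol, so
that quantifier clauses become first-order. -/
theorem UnaryFormula.map_instLast {n x : ℕ} (A : UnaryFormula (S.slots n) x) (𝔄 : Structure S)
    (a : Fin n → 𝔄.Domain) (b : 𝔄.Domain) :
    A.instLast.map (𝔄.fill (Fin.snoc a b : Fin (n + 1) → 𝔄.Domain)) =
      (A.map (𝔄.fill a)).inst (𝔄.name b) := by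
  rw [instLast, map_inst, ← map_comp, 𝔄.fill_comp_renameSlots]
  congr 2
  · congr 1
    funext i
    simp
  · simp [Structure.fill, Signature.slot, Structure.name]
    rfl

/-! ### The classical language and the coherence conditions -/

/-- The function symbols of the classical language: the individual constants. -/
inductive ConstSymbol (S : Signature.{u}) : ℕ → Type u
  | mk (c : S.Const) : ConstSymbol S 0

/-- The classical language that describes the interpretations of `S`: it has the individual
constants and, for every sentence with `n` slots, an `n`-ary relation symbol. -/
def classical (S : Signature.{u}) : FirstOrder.Language.{u, u} where
  Functions := ConstSymbol S
  Relations n := Sentence (S.slots n)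

/-- The individual constant `c`, as a constant of the classical language. -/
def constSymbol (c : S.Const) : (classical S).Constants := ConstSymbol.mk c

section Classical

variable {N : Type u} [(classical S).Structure N]

variable (N) in
/-- The denotation of an individual constant in a classical structure. -/
def constVal (c : S.Const) : N := constSymbol c

/-- The denotation of a constant in a classical structure, given the values of the slots. -/
def den {n : ℕ} (a : Fin n → N) : (S.slots n).Const → N :=
  Sum.elim (constVal N) fun i => a i.down

/-- The sentence `A`, with its slots filled by elements of a classical structure, is true there. -/
def Sat {n : ℕ} (A : Sentence (S.slots n)) (a : Fin n → N) : Prop :=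
  FirstOrder.Language.Structure.RelMap (L := classical S) (n := n) A a

end Classical

/-- The sentence `P(c₁, …, cₙ)` over distinct slots `c₁, …, cₙ`. -/
def Signature.slotAtom {n : ℕ} (P : S.Pred n) : Sentence (S.slots n) :=
  Sentence.rel (S := S.slots n) P S.slot

/-- The first-order conditions under which a classical structure describes an interpretation. -/
structure Coherent (S : Signature.{u}) (N : Type u) [(classical S).Structure N] : Prop where
  -- No valuation clause corresponds to this: it makes truth depend on the filled sentence alone,
  -- not on the choice of slots.
  rename : ∀ {m n : ℕ} (f : Fin m → Fin n) (A : Sentence (S.slots m)) (a : Fin n → N),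
    Sat (A.map (S.renameSlots f)) a ↔ Sat A (a ∘ f)
  eq : ∀ a : Fin 2 → N, Sat (Signature.slotAtom S.eq) a ↔ a 0 = a 1
  -- Atoms reduce to the atom over distinct slots, from which the extension of `P` is read off.
  rel : ∀ {m n : ℕ} (P : S.Pred m) (c : Fin m → (S.slots n).Const) (a : Fin n → N),
    Sat (.rel (S := S.slots n) P c) a ↔ Sat (Signature.slotAtom P) fun i => den a (c i)
  neg_rel : ∀ {m n : ℕ} (P : S.Pred m) (c : Fin m → (S.slots n).Const) (a : Fin n → N),
    Sat (.neg (.rel (S := S.slots n) P c)) a ↔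
      Sat (.neg (Signature.slotAtom P)) fun i => den a (c i)
  and : ∀ {n : ℕ} (A B : Sentence (S.slots n)) (a : Fin n → N),
    Sat (.and A B) a ↔ Sat A a ∧ Sat B a
  or : ∀ {n : ℕ} (A B : Sentence (S.slots n)) (a : Fin n → N),
    Sat (.or A B) a ↔ Sat A a ∨ Sat B a
  neg_and : ∀ {n : ℕ} (A B : Sentence (S.slots n)) (a : Fin n → N),
    Sat (.neg (.and A B)) a ↔ Sat (.neg A) a ∨ Sat (.neg B) a
  neg_or : ∀ {n : ℕ} (A B : Sentence (S.slots n)) (a : Fin n → N),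
    Sat (.neg (.or A B)) a ↔ Sat (.neg A) a ∧ Sat (.neg B) a
  neg_neg : ∀ {n : ℕ} (A : Sentence (S.slots n)) (a : Fin n → N),
    Sat (.neg (.neg A)) a ↔ Sat A a
  of_circ : ∀ {n : ℕ} (A : Sentence (S.slots n)) (a : Fin n → N),
    Sat (.circ A) a → (Sat A a ↔ ¬ Sat (.neg A) a)
  circ : ∀ {n : ℕ} (A : Sentence (S.slots n)) (a : Fin n → N),
    Sat (.circ A) a ↔ ¬ Sat (.bullet A) a
  all : ∀ {n x : ℕ} (A : UnaryFormula (S.slots n) x) (hx : A.1.FreeIn x) (a : Fin n → N),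
    Sat (.all A hx) a ↔ ∀ b : N, Sat A.instLast (Fin.snoc a b : Fin (n + 1) → N)
  ex : ∀ {n x : ℕ} (A : UnaryFormula (S.slots n) x) (hx : A.1.FreeIn x) (a : Fin n → N),
    Sat (.ex A hx) a ↔ ∃ b : N, Sat A.instLast (Fin.snoc a b : Fin (n + 1) → N)
  neg_all : ∀ {n x : ℕ} (A : UnaryFormula (S.slots n) x) (hx : A.1.FreeIn x) (a : Fin n → N),
    Sat (.neg (.all A hx)) a ↔ ∃ b : N, Sat A.instLast.neg (Fin.snoc a b : Fin (n + 1) → N)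
  neg_ex : ∀ {n x : ℕ} (A : UnaryFormula (S.slots n) x) (hx : A.1.FreeIn x) (a : Fin n → N),
    Sat (.neg (.ex A hx)) a ↔ ∀ b : N, Sat A.instLast.neg (Fin.snoc a b : Fin (n + 1) → N)
  alphVar : ∀ {n : ℕ} (A A' : Sentence (S.slots n)), PreFormula.AlphVar A.1 A'.1 →
    ∀ a : Fin n → N, Sat A' a ↔ Sat A a
  subst : ∀ {n x : ℕ} (A : UnaryFormula (S.slots n) x) (c₁ c₂ : (S.slots n).Const) (a : Fin n → N),
    den a c₁ = den a c₂ → (Sat (A.inst c₁) a ↔ Sat (A.inst c₂) a) →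
      (Sat (.neg (A.inst c₁)) a ↔ Sat (.neg (A.inst c₂)) a) ∧
      (Sat (.circ (A.inst c₁)) a ↔ Sat (.circ (A.inst c₂)) a) ∧
      (Sat (.bullet (A.inst c₁)) a ↔ Sat (.bullet (A.inst c₂)) a)

/-! ### Transfer along elementary equivalence -/

section Transfer

open FirstOrder FirstOrder.Language

/-- The term that names a constant. -/
def constTerm {n : ℕ} : (S.slots n).Const → (classical S).Term (Empty ⊕ Fin n) :=
  Sum.elim (fun c => (constSymbol c).term)
    fun i => FirstOrder.Language.Term.var (.inr i.down)

/-- The atomic formula that says that a sentence is true when its slots are filled by the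
values of given terms. -/
def satAt {m n : ℕ} (A : Sentence (S.slots m)) (t : Fin m → (classical S).Term (Empty ⊕ Fin n)) :
    (classical S).BoundedFormula Empty n :=
  BoundedFormula.rel (L := classical S) (l := m) A t

/-- The atomic formula that says that a sentence is true. -/
def sat {n : ℕ} (A : Sentence (S.slots n)) : (classical S).BoundedFormula Empty n :=
  satAt A fun i => FirstOrder.Language.Term.var (.inr i)

variable {M N : Type u} [(classical S).Structure M] [(classical S).Structure N]

theorem realize_constTerm {n : ℕ} (c : (S.slots n).Const) (a : Fin n → N) (v : Empty → N) :
    (constTerm c).realize (Sum.elim v a) = den a c := by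
  cases c with
  | inl c => exact Term.realize_constants
  | inr i => rfl

theorem realize_satAt {m n : ℕ} (A : Sentence (S.slots m))
    (t : Fin m → (classical S).Term (Empty ⊕ Fin n)) (a : Fin n → N) (v : Empty → N) :
    (satAt A t).Realize v a ↔ Sat A fun i => (t i).realize (Sum.elim v a) :=
  Iff.rfl

theorem realize_sat {n : ℕ} (A : Sentence (S.slots n)) (a : Fin n → N) (v : Empty → N) :
    (sat A).Realize v a ↔ Sat A a :=
  Iff.rfl

/-- Validity of `φ` is truth of the sentence `φ.alls`, which elementary equivalence preserves. -/
theorem forall_realize_of_equiv (h : M ≅[classical S] N) {n : ℕ}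
    (φ : (classical S).BoundedFormula Empty n) (hφ : ∀ a : Fin n → M, φ.Realize default a)
    (a : Fin n → N) : φ.Realize default a :=
  BoundedFormula.realize_alls.1
    ((elementarilyEquivalent_iff.1 h φ.alls).1 (BoundedFormula.realize_alls.2 hφ)) a

/-- Once the syntactic parameters are fixed, each condition says that a single first-order formula
is valid. Quantification over sentences stays outside the language, as an axiom scheme. -/
theorem Coherent.of_equiv (h : M ≅[classical S] N) (hM : Coherent S M) : Coherent S N where
  rename f A := by
    have := forall_realize_of_equiv h ((sat (A.map (S.renameSlots f))).iff
      (satAt A fun i => .var (.inr (f i))))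
    simp only [BoundedFormula.realize_iff, realize_sat, realize_satAt] at this
    exact this (hM.rename f A)
  eq := by
    have := forall_realize_of_equiv h ((sat (Signature.slotAtom S.eq)).iff
      (Term.bdEqual (.var (.inr 0)) (.var (.inr 1))))
    simp only [BoundedFormula.realize_iff, realize_sat, BoundedFormula.realize_bdEqual] at this
    exact this hM.eq
  rel P c := by
    have := forall_realize_of_equiv h ((sat (.rel (S := S.slots _) P c)).iff
      (satAt (Signature.slotAtom P) fun i => constTerm (c i)))
    simp only [BoundedFormula.realize_iff, realize_sat, realize_satAt, realize_constTerm] at this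
    exact this (hM.rel P c)
  neg_rel P c := by
    have := forall_realize_of_equiv h ((sat (.neg (.rel (S := S.slots _) P c))).iff
      (satAt (.neg (Signature.slotAtom P)) fun i => constTerm (c i)))
    simp only [BoundedFormula.realize_iff, realize_sat, realize_satAt, realize_constTerm] at this
    exact this (hM.neg_rel P c)
  and A B := by
    have := forall_realize_of_equiv h ((sat (.and A B)).iff (sat A ⊓ sat B))
    simp only [BoundedFormula.realize_iff, realize_sat, BoundedFormula.realize_inf] at this
    exact this (hM.and A B)
  or A B := by
    have := forall_realize_of_equiv h ((sat (.or A B)).iff (sat A ⊔ sat B))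
    simp only [BoundedFormula.realize_iff, realize_sat, BoundedFormula.realize_sup] at this
    exact this (hM.or A B)
  neg_and A B := by
    have := forall_realize_of_equiv h
      ((sat (.neg (.and A B))).iff (sat (.neg A) ⊔ sat (.neg B)))
    simp only [BoundedFormula.realize_iff, realize_sat, BoundedFormula.realize_sup] at this
    exact this (hM.neg_and A B)
  neg_or A B := by
    have := forall_realize_of_equiv h
      ((sat (.neg (.or A B))).iff (sat (.neg A) ⊓ sat (.neg B)))
    simp only [BoundedFormula.realize_iff, realize_sat, BoundedFormula.realize_inf] at this
    exact this (hM.neg_or A B)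
  neg_neg A := by
    have := forall_realize_of_equiv h ((sat (.neg (.neg A))).iff (sat A))
    simp only [BoundedFormula.realize_iff, realize_sat] at this
    exact this (hM.neg_neg A)
  of_circ A := by
    have := forall_realize_of_equiv h
      ((sat (.circ A)).imp ((sat A).iff (sat (.neg A)).not))
    simp only [BoundedFormula.realize_iff, BoundedFormula.realize_imp, BoundedFormula.realize_not,
      realize_sat] at this
    exact this (hM.of_circ A)
  circ A := by
    have := forall_realize_of_equiv h ((sat (.circ A)).iff (sat (.bullet A)).not)
    simp only [BoundedFormula.realize_iff, BoundedFormula.realize_not, realize_sat] at this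
    exact this (hM.circ A)
  all A hx := by
    have := forall_realize_of_equiv h ((sat (.all A hx)).iff (sat A.instLast).all)
    simp only [BoundedFormula.realize_iff, BoundedFormula.realize_all, realize_sat] at this
    exact this (hM.all A hx)
  ex A hx := by
    have := forall_realize_of_equiv h ((sat (.ex A hx)).iff (sat A.instLast).ex)
    simp only [BoundedFormula.realize_iff, BoundedFormula.realize_ex, realize_sat] at this
    exact this (hM.ex A hx)
  neg_all A hx := by
    have := forall_realize_of_equiv h ((sat (.neg (.all A hx))).iff (sat A.instLast.neg).ex)
    simp only [BoundedFormula.realize_iff, BoundedFormula.realize_ex, realize_sat] at this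
    exact this (hM.neg_all A hx)
  neg_ex A hx := by
    have := forall_realize_of_equiv h ((sat (.neg (.ex A hx))).iff (sat A.instLast.neg).all)
    simp only [BoundedFormula.realize_iff, BoundedFormula.realize_all, realize_sat] at this
    exact this (hM.neg_ex A hx)
  alphVar A A' hA := by
    have := forall_realize_of_equiv h ((sat A').iff (sat A))
    simp only [BoundedFormula.realize_iff, realize_sat] at this
    exact this (hM.alphVar A A' hA)
  subst A c₁ c₂ := by
    have := forall_realize_of_equiv h
      (((constTerm c₁).bdEqual (constTerm c₂)).imp
        (((sat (A.inst c₁)).iff (sat (A.inst c₂))).imp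
          (((sat (A.inst c₁).neg).iff (sat (A.inst c₂).neg)) ⊓
            (((sat (A.inst c₁).circ).iff (sat (A.inst c₂).circ)) ⊓
              ((sat (A.inst c₁).bullet).iff (sat (A.inst c₂).bullet))))))
    simp only [BoundedFormula.realize_iff, BoundedFormula.realize_imp, BoundedFormula.realize_inf,
      BoundedFormula.realize_bdEqual, realize_constTerm, realize_sat] at this
    exact this (hM.subst A c₁ c₂)

theorem sat_iff_of_equiv (h : M ≅[classical S] N) (A : Sentence (S.slots 0)) (a : Fin 0 → M)
    (b : Fin 0 → N) : Sat A a ↔ Sat A b := by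
  have := elementarilyEquivalent_iff.1 h (sat A).alls
  simp only [FirstOrder.Language.Sentence.Realize, Formula.Realize, BoundedFormula.alls] at this
  rw [Subsingleton.elim a default, Subsingleton.elim b default]
  exact this

end Transfer

/-! ### The size of the classical language -/

open Cardinal in
-- Finitely many slots do not enlarge an infinite signature, and there are only countably many
-- arities.
theorem card_classical_le (S : Signature.{u}) : (classical S).card ≤ S.card := by
  have hω := S.aleph0_le_card
  have hC : #S.Const ≤ S.card := mk_le_of_injective (Sum.inl_injective (β := Σ n, S.Pred n))
  have hslots : ∀ n, (S.slots n).card ≤ S.card := by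
    intro n
    have e : (S.slots n).card = #((S.Const ⊕ ULift.{u} (Fin n)) ⊕ Σ n, S.Pred n) := rfl
    rw [e, mk_sum, lift_id, lift_id, mk_sum, lift_id, lift_id]
    refine add_le_of_le hω (add_le_of_le hω hC ?_) ?_
    · exact (mk_le_aleph0 (α := ULift.{u} (Fin n))).trans hω
    · exact mk_le_of_injective (Sum.inr_injective (α := S.Const))
  rw [FirstOrder.Language.card, FirstOrder.Language.Symbols, mk_sum, lift_id, lift_id]
  refine add_le_of_le hω ?_ ?_
  · refine (mk_le_of_surjective (f := fun c : S.Const => ⟨0, .mk c⟩) ?_).trans hC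
    rintro ⟨_, ⟨c⟩⟩
    exact ⟨c, rfl⟩
  · rw [mk_sigma]
    refine (sum_le_sum _ (fun _ => S.card) fun n => (Sentence.mk_le _).trans (hslots n)).trans ?_
    rw [sum_const, lift_uzero, mk_nat, lift_aleph0]
    exact mul_le_of_le hω hω le_rfl

/-! ### From interpretations to coherent classical structures -/

namespace Interpretation

/-- The classical structure that describes an interpretation. -/
@[reducible]
def toClassical (M : Interpretation S) : (classical S).Structure M.str.Domain where
  funMap f _ := match f with
    | .mk c => M.str.const c
  RelMap {_} A a := M.val (Sentence.map (M.str.fill a) A) = true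

variable (M : Interpretation S)

theorem sat_iff {n : ℕ} (A : Sentence (S.slots n)) (a : Fin n → M.str.Domain) :
    (letI := M.toClassical; Sat A a) ↔ M.val (A.map (M.str.fill a)) = true :=
  Iff.rfl

theorem den_eq {n : ℕ} (a : Fin n → M.str.Domain) (c : (S.slots n).Const) :
    (letI := M.toClassical; den a c) = M.str.hat.const ((M.str.fill a).onConst c) := by
  cases c <;> rfl

theorem coherent : letI := M.toClassical; Coherent S M.str.Domain := by
  let _ := M.toClassical
  have hv := M.isValuation
  have hall : ∀ {n x : ℕ} (A : UnaryFormula (S.slots n) x) (a : Fin n → M.str.Domain)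
      (b : M.str.Domain), Sat A.instLast (Fin.snoc a b : Fin (n + 1) → M.str.Domain) ↔
        M.val ((A.map (M.str.fill a)).inst (M.str.name b)) = true := by
    intro n x A a b
    rw [sat_iff, A.map_instLast]
  have hneg : ∀ {n x : ℕ} (A : UnaryFormula (S.slots n) x) (a : Fin n → M.str.Domain)
      (b : M.str.Domain), Sat A.instLast.neg (Fin.snoc a b : Fin (n + 1) → M.str.Domain) ↔
        M.val ((A.map (M.str.fill a)).inst (M.str.name b)).neg = true := by
    intro n x A a b
    rw [sat_iff, ← A.map_instLast]
    rfl
  have hfree : ∀ {n x : ℕ} (A : UnaryFormula (S.slots n) x) (a : Fin n → M.str.Domain),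
      A.1.FreeIn x → (A.map (M.str.fill a)).1.FreeIn x :=
    fun A a => (PreFormula.freeIn_map _ _ A.1).2
  exact {
    rename := fun f A a => by
      rw [sat_iff, sat_iff, ← Sentence.map_comp, M.str.fill_comp_renameSlots]
    eq := fun a => by
      refine (hv.rel (n := 2) S.eq fun i => M.str.name (a i)).trans ?_
      change a ∈ M.str.pos S.eq ↔ _
      rw [M.str.pos_eq]
      rfl
    rel := fun P c a => by
      -- The two atoms have constants with the same denotations, so the atomic clause imposes the
      -- same condition on both.
      have h₁ := hv.rel P fun i => (M.str.fill a).onConst (c i)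
      have h₂ := hv.rel P fun i => M.str.name (den a (c i))
      simp only [den_eq] at h₂ ⊢
      exact h₁.trans h₂.symm
    neg_rel := fun P c a => by
      have h₁ := hv.neg_rel P fun i => (M.str.fill a).onConst (c i)
      have h₂ := hv.neg_rel P fun i => M.str.name (den a (c i))
      simp only [den_eq] at h₂ ⊢
      exact h₁.trans h₂.symm
    and := fun A B a => hv.and (A.map (M.str.fill a)) (B.map (M.str.fill a))
    or := fun A B a => hv.or (A.map (M.str.fill a)) (B.map (M.str.fill a))
    neg_and := fun A B a => hv.neg_and (A.map (M.str.fill a)) (B.map (M.str.fill a))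
    neg_or := fun A B a => hv.neg_or (A.map (M.str.fill a)) (B.map (M.str.fill a))
    neg_neg := fun A a => hv.neg_neg (A.map (M.str.fill a))
    of_circ := fun A a h => by
      refine (hv.of_circ (A.map (M.str.fill a)) h).trans ?_
      rw [sat_iff, Bool.not_eq_true]
      rfl
    circ := fun A a => by
      refine (hv.circ (A.map (M.str.fill a))).trans ?_
      rw [sat_iff, Bool.not_eq_true]
      rfl
    all := fun A hx a => by
      simp only [hall]
      exact hv.all (A.map (M.str.fill a)) (hfree A a hx)
    ex := fun A hx a => by
      simp only [hall]
      exact hv.ex (A.map (M.str.fill a)) (hfree A a hx)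
    neg_all := fun A hx a => by
      simp only [hneg]
      exact hv.neg_all (A.map (M.str.fill a)) (hfree A a hx)
    neg_ex := fun A hx a => by
      simp only [hneg]
      exact hv.neg_ex (A.map (M.str.fill a)) (hfree A a hx)
    alphVar := fun A A' h a => by
      rw [sat_iff, sat_iff, hv.alphVar (A.map (M.str.fill a)) (A'.map (M.str.fill a)) (h.map (M.str.fill a))]
    subst := fun A c₁ c₂ a hc h => by
      rw [den_eq, den_eq] at hc
      rw [sat_iff, sat_iff, A.map_inst, A.map_inst, ← Bool.eq_iff_iff] at h
      obtain ⟨h₁, h₂, h₃⟩ := hv.subst (A.map (M.str.fill a)) _ _ hc h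
      rw [← A.map_inst, ← A.map_inst] at h₁ h₂ h₃
      exact ⟨Bool.eq_iff_iff.1 h₁, Bool.eq_iff_iff.1 h₂, Bool.eq_iff_iff.1 h₃⟩ }

end Interpretation

/-! ### From coherent classical structures to interpretations -/

namespace Coherent

variable {N : Type u} [(classical S).Structure N]

/-- The `S`-structure that is described by a classical structure. -/
def toStructure [Nonempty N] (hN : Coherent S N) : Structure S where
  Domain := N
  nonempty_domain := inferInstance
  const := constVal N
  pos P := {a | Sat (Signature.slotAtom P) a}
  neg P := {a | Sat (.neg (Signature.slotAtom P)) a}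
  pos_eq := Set.ext hN.eq

variable [Nonempty N] (hN : Coherent S N)

/-- A sentence of the diagram signature is true if it arises from a true sentence by filling its
slots. -/
def True (A : Sentence hN.toStructure.diagram) : Prop :=
  ∃ (n : ℕ) (B : Sentence (S.slots n)) (a : Fin n → N), B.map (hN.toStructure.fill a) = A ∧ Sat B a

/-- Well-definedness of `True`. With one common tuple `c` covering the values of `a` and `b`,
unfilling the shared diagram sentence shows that `A` and `B` become equal after renaming their
slots; `rename` then compares both with this sentence at `c`. -/
theorem sat_congr {m n : ℕ} {A : Sentence (S.slots m)} {B : Sentence (S.slots n)} {a : Fin m → N}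
    {b : Fin n → N} (h : A.map (hN.toStructure.fill a) = B.map (hN.toStructure.fill b)) :
    Sat A a ↔ Sat B b := by
  obtain ⟨k, c, j, hc⟩ := hN.toStructure.exists_unfill
    (F := Set.range fun i => hN.toStructure.name (Sum.elim a b i)) (Set.finite_range _)
  have ha : c ∘ (j ∘ a) = a := funext fun i => Sum.inr_injective (hc _ ⟨.inl i, rfl⟩)
  have hb : c ∘ (j ∘ b) = b := funext fun i => Sum.inr_injective (hc _ ⟨.inr i, rfl⟩)
  have key : A.map (S.renameSlots (j ∘ a)) = B.map (S.renameSlots (j ∘ b)) := by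
    rw [← hN.toStructure.unfill_comp_fill j a, ← hN.toStructure.unfill_comp_fill j b,
      Sentence.map_comp, Sentence.map_comp, h]
  have h₁ := (hN.rename (j ∘ a) A c).trans (iff_of_eq (congrArg (Sat A) ha))
  have h₂ := (hN.rename (j ∘ b) B c).trans (iff_of_eq (congrArg (Sat B) hb))
  rw [← h₁, ← h₂, key]

theorem true_map {n : ℕ} (A : Sentence (S.slots n)) (a : Fin n → N) :
    hN.True (A.map (hN.toStructure.fill a)) ↔ Sat A a :=
  ⟨fun ⟨_, _, _, h, hB⟩ => (hN.sat_congr h).1 hB, fun h => ⟨n, A, a, rfl, h⟩⟩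

theorem exists_eq_map (A : Sentence hN.toStructure.diagram) :
    ∃ (n : ℕ) (a : Fin n → N) (B : Sentence (S.slots n)), A = B.map (hN.toStructure.fill a) := by
  obtain ⟨n, a, j, h⟩ := hN.toStructure.exists_unfill A.1.finite_consts
  exact ⟨n, a, _, (hN.toStructure.map_unfill_fill h).symm⟩

/-- Both sentences are unfilled by the same translation, so they share one tuple of slots and
alphabetic variance is preserved. -/
theorem exists_eq_map₂ (A B : Sentence hN.toStructure.diagram) :
    ∃ (n : ℕ) (a : Fin n → N) (A' B' : Sentence (S.slots n)),
      A = A'.map (hN.toStructure.fill a) ∧ B = B'.map (hN.toStructure.fill a) ∧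
        (PreFormula.AlphVar A.1 B.1 → PreFormula.AlphVar A'.1 B'.1) := by
  obtain ⟨n, a, j, h⟩ := hN.toStructure.exists_unfill (A.1.finite_consts.union B.1.finite_consts)
  exact ⟨n, a, _, _, (hN.toStructure.map_unfill_fill fun c hc => h c (.inl hc)).symm,
    (hN.toStructure.map_unfill_fill fun c hc => h c (.inr hc)).symm, .map _⟩

theorem exists_eq_map_unary {x : ℕ} (A : UnaryFormula hN.toStructure.diagram x) :
    ∃ (n : ℕ) (a : Fin n → N) (B : UnaryFormula (S.slots n) x),
      A = B.map (hN.toStructure.fill a) := by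
  obtain ⟨n, a, j, h⟩ := hN.toStructure.exists_unfill A.1.finite_consts
  exact ⟨n, a, _, (hN.toStructure.map_unfill_fill_unary h).symm⟩

theorem exists_eq_map_unary_onConst {x : ℕ} (A : UnaryFormula hN.toStructure.diagram x)
    (c₁ c₂ : hN.toStructure.diagram.Const) :
    ∃ (n : ℕ) (a : Fin n → N) (B : UnaryFormula (S.slots n) x) (d₁ d₂ : (S.slots n).Const),
      A = B.map (hN.toStructure.fill a) ∧ c₁ = (hN.toStructure.fill a).onConst d₁ ∧
        c₂ = (hN.toStructure.fill a).onConst d₂ := by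
  obtain ⟨n, a, j, h⟩ := hN.toStructure.exists_unfill
    ((A.1.finite_consts.insert c₂).insert c₁)
  exact ⟨n, a, _, _, _,
    (hN.toStructure.map_unfill_fill_unary fun c hc => h c (.inr (.inr hc))).symm,
    (h c₁ (.inl rfl)).symm, (h c₂ (.inr (.inl rfl))).symm⟩

theorem exists_eq_onConst {m : ℕ} (c : Fin m → hN.toStructure.diagram.Const) :
    ∃ (n : ℕ) (a : Fin n → N) (d : Fin m → (S.slots n).Const),
      c = fun i => (hN.toStructure.fill a).onConst (d i) := by
  obtain ⟨n, a, j, h⟩ := hN.toStructure.exists_unfill (Set.finite_range c)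
  exact ⟨n, a, fun i => _, funext fun i => (h _ ⟨i, rfl⟩).symm⟩

theorem hat_const_fill {n : ℕ} (a : Fin n → N) (c : (S.slots n).Const) :
    hN.toStructure.hat.const ((hN.toStructure.fill a).onConst c) = den a c := by
  cases c <;> rfl

open scoped Classical in
/-- The valuation that is described by a classical structure. -/
noncomputable def val (A : Sentence hN.toStructure.diagram) : Bool := decide (hN.True A)

theorem val_map {n : ℕ} (A : Sentence (S.slots n)) (a : Fin n → N) :
    hN.val (A.map (hN.toStructure.fill a)) = true ↔ Sat A a := by
  classical
  exact decide_eq_true_iff.trans (hN.true_map A a)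

theorem val_inst {n x : ℕ} (A : UnaryFormula (S.slots n) x) (a : Fin n → N) (b : N) :
    hN.val ((A.map (hN.toStructure.fill a)).inst (hN.toStructure.name b)) = true ↔
      Sat A.instLast (Fin.snoc a b : Fin (n + 1) → N) := by
  rw [← hN.val_map, ← A.map_instLast hN.toStructure a b]
  rfl

theorem val_neg_inst {n x : ℕ} (A : UnaryFormula (S.slots n) x) (a : Fin n → N) (b : N) :
    hN.val ((A.map (hN.toStructure.fill a)).inst (hN.toStructure.name b)).neg = true ↔
      Sat A.instLast.neg (Fin.snoc a b : Fin (n + 1) → N) := by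
  rw [← hN.val_map, ← A.map_instLast hN.toStructure a b]
  rfl

/-- Every clause involves finitely many constants, so its ingredients can be written over a common
tuple of slots, where it is the corresponding coherence condition. -/
theorem isValuation : IsValuation hN.toStructure hN.val where
  rel {m} P c := by
    obtain ⟨n, a, d, rfl⟩ := hN.exists_eq_onConst c
    refine (hN.val_map (.rel (S := S.slots n) P d) a).trans ((hN.rel P d a).trans ?_)
    simp only [hat_const_fill]
    rfl
  neg_rel {m} P c := by
    obtain ⟨n, a, d, rfl⟩ := hN.exists_eq_onConst c
    refine (hN.val_map (.neg (.rel (S := S.slots n) P d)) a).trans ((hN.neg_rel P d a).trans ?_)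
    simp only [hat_const_fill]
    rfl
  and A B := by
    obtain ⟨n, a, A, B, rfl, rfl, -⟩ := hN.exists_eq_map₂ A B
    rw [hN.val_map, hN.val_map, ← hN.and, ← hN.val_map]
    rfl
  or A B := by
    obtain ⟨n, a, A, B, rfl, rfl, -⟩ := hN.exists_eq_map₂ A B
    rw [hN.val_map, hN.val_map, ← hN.or, ← hN.val_map]
    rfl
  neg_and A B := by
    obtain ⟨n, a, A, B, rfl, rfl, -⟩ := hN.exists_eq_map₂ A B
    have h := hN.neg_and A B a
    simp only [← hN.val_map] at h
    exact h
  neg_or A B := by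
    obtain ⟨n, a, A, B, rfl, rfl, -⟩ := hN.exists_eq_map₂ A B
    have h := hN.neg_or A B a
    simp only [← hN.val_map] at h
    exact h
  neg_neg A := by
    obtain ⟨n, a, A, rfl⟩ := hN.exists_eq_map A
    have h := hN.neg_neg A a
    simp only [← hN.val_map] at h
    exact h
  of_circ A := by
    obtain ⟨n, a, A, rfl⟩ := hN.exists_eq_map A
    have h := hN.of_circ A a
    simp only [← hN.val_map, Bool.not_eq_true] at h
    exact h
  circ A := by
    obtain ⟨n, a, A, rfl⟩ := hN.exists_eq_map A
    have h := hN.circ A a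
    simp only [← hN.val_map, Bool.not_eq_true] at h
    exact h
  all A hx := by
    obtain ⟨n, a, A, rfl⟩ := hN.exists_eq_map_unary A
    have h := hN.all A ((PreFormula.freeIn_map _ _ A.1).1 hx) a
    rw [← hN.val_map] at h
    simp only [← hN.val_inst] at h
    exact h
  ex A hx := by
    obtain ⟨n, a, A, rfl⟩ := hN.exists_eq_map_unary A
    have h := hN.ex A ((PreFormula.freeIn_map _ _ A.1).1 hx) a
    rw [← hN.val_map] at h
    simp only [← hN.val_inst] at h
    exact h
  neg_all A hx := by
    obtain ⟨n, a, A, rfl⟩ := hN.exists_eq_map_unary A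
    have h := hN.neg_all A ((PreFormula.freeIn_map _ _ A.1).1 hx) a
    rw [← hN.val_map] at h
    simp only [← hN.val_neg_inst] at h
    exact h
  neg_ex A hx := by
    obtain ⟨n, a, A, rfl⟩ := hN.exists_eq_map_unary A
    have h := hN.neg_ex A ((PreFormula.freeIn_map _ _ A.1).1 hx) a
    rw [← hN.val_map] at h
    simp only [← hN.val_neg_inst] at h
    exact h
  alphVar A A' hA := by
    obtain ⟨n, a, A, A', rfl, rfl, hA'⟩ := hN.exists_eq_map₂ A A'
    rw [Bool.eq_iff_iff, hN.val_map, hN.val_map]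
    exact hN.alphVar A A' (hA' hA) a
  subst A c₁ c₂ hc h := by
    obtain ⟨n, a, A, c₁, c₂, rfl, rfl, rfl⟩ := hN.exists_eq_map_unary_onConst A c₁ c₂
    rw [hat_const_fill, hat_const_fill] at hc
    rw [← A.map_inst, ← A.map_inst] at h ⊢
    rw [Bool.eq_iff_iff, hN.val_map, hN.val_map] at h
    have key := hN.subst A c₁ c₂ a hc h
    simp only [← hN.val_map, ← Bool.eq_iff_iff] at key
    exact key

/-- The interpretation that is described by a classical structure. -/
noncomputable def toInterpretation : Interpretation S := ⟨hN.toStructure, hN.val, hN.isValuation⟩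

/-- A sentence of `S` uses no slots, so its truth is that of a nullary relation symbol, which
elementary equivalence preserves. -/
theorem holds_iff (A : Sentence S) :
    hN.toInterpretation.Holds A ↔ Sat (N := N) (A.map (S.toSlots 0)) Fin.elim0 := by
  rw [← hN.val_map, ← Sentence.map_comp]
  rfl

end Coherent

/-! ### The Löwenheim–Skolem theorem -/

theorem Interpretation.holds_iff (M : Interpretation S) (A : Sentence S) :
    M.Holds A ↔ (letI := M.toClassical; Sat (N := M.str.Domain) (A.map (S.toSlots 0)) Fin.elim0) := by
  rw [sat_iff, ← Sentence.map_comp]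
  rfl

/-- An infinite interpretation has the same true sentences as some interpretation of any given
cardinality that is at least the cardinality of the signature. -/
theorem Interpretation.exists_holds_iff_card_eq (M : Interpretation S) [Infinite M.str.Domain]
    {κ : Cardinal.{u}} (hκ : S.card ≤ κ) :
    ∃ M' : Interpretation S, (∀ A, M'.Holds A ↔ M.Holds A) ∧ M'.card = κ := by
  let _ := M.toClassical
  have hω := S.aleph0_le_card.trans hκ
  -- The classical theorem is used in both directions, since `κ` may be smaller than the domain of
  -- `M`.
  obtain ⟨N, hMN, hN⟩ := FirstOrder.Language.exists_elementarilyEquivalent_card_eq (classical S)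
    M.str.Domain κ hω (by simpa using (card_classical_le S).trans hκ)
  have hc : Coherent S N := Coherent.of_equiv hMN M.coherent
  -- This supplies the non-emptiness of the domain that `toInterpretation` needs.
  have : Infinite N := Cardinal.infinite_iff.2 (hN ▸ hω)
  refine ⟨hc.toInterpretation, fun A => ?_, hN⟩
  rw [hc.holds_iff, M.holds_iff]
  exact (sat_iff_of_equiv hMN _ _ _).symm

end QLETF

theorem mainTheorem5 (S : QLETF.Signature.{u}) (Γ : Set (QLETF.Sentence S))
    (x y : ℕ) (hxy : x ≠ y)
    (hΓ : QLETF.Entails Γ (QLETF.Sentence.allCircEq S x y hxy))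
    (hinf : ∃ M : QLETF.Interpretation S, M.IsModel Γ ∧ Infinite M.str.Domain)
    (κ : Cardinal.{u}) (hκ : S.card ≤ κ) :
    ∃ M : QLETF.Interpretation S, M.IsModel Γ ∧ M.card = κ := by
  obtain ⟨M, hM, _⟩ := hinf
  obtain ⟨M', h, hcard⟩ := M.exists_holds_iff_card_eq hκ
  exact ⟨M', fun A hA => (h A).2 (hM A hA), hcard⟩
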